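/- **Setting.** Let $d\in\mathbb N$ and let $\mathcal L:\mathbb R^d\to\mathbb R$ be differentiable, with $L\in\mathbb R$ and $\mu>0$ such that for all $\theta,\theta'$ $$\tfrac{\mu}{2}\|\theta-\theta'\|^2\le \mathcal L(\theta')-\mathcal L(\theta)-\langle\nabla\mathcal L(\theta),\theta'-\theta\rangle\le \tfrac L2\|\theta-\theta'\|^2 ,$$ and let $\theta^\star$ be its minimizer. For each $\theta\in\mathbb R^d$ let $\mathcal D(\theta)$ be a probability distribution on $\mathbb R^d$ (depending measurably on $\theta$), the distribution of an (uncorrupted) gradient sample $\widetilde G(\theta)$. Put $\varepsilon_\theta=\widetilde G(\theta)-\nabla\mathcal L(\theta)$ and assume: * $\mathbb E[\varepsilon_\theta]=0$ for all $\theta$; * there are a weight $w\in(0,1]$ and a function $\varkappa:(0,\infty)\to(0,\infty)$ such that for every $\theta$ the law of $\varepsilon_\theta$ is $w\,\nu_{\theta,1}+(1-w)\,\nu_{\theta,2}$ with probability measures $\nu_{\theta,1},\nu_{\theta,2}$, where $\nu_{\theta,1}$ has a Lebesgue density $h_\theta$ with $\inf_{\|\omega\|\le R}h_\theta(\omega)>\varkappa(R)$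 for all $R>0$; * for some $q>1$, $A_q\ge 0$, $B_q>0$: $\ \mathbb E[\|\varepsilon_\theta\|^q]^{1/q}\le A_q\|\theta-\theta^\star\|+B_q$ for all $\theta$. Let $\Theta\subset\mathbb R^d$ be closed, convex and bounded with $\theta^\star\in\Theta$, let $\Pi_\Theta$ be the Euclidean projection onto $\Theta$, let $p\in(0,1)$ and let $\tau_\theta$ be the $p$-th quantile of $\|\widetilde G(\theta)\|$. Set $\overline\tau=\sup_{\theta\in\Theta}\tau_\theta$ and $\overline B_q=A_q\operatorname{diam}(\Theta)+B_q$. Projected quantile-clipped SGD without corruption, with step size $\beta>0$, started at $\theta_0\in\mathbb R^d$, is the Markov chain $$\theta_{t+1}=\Pi_\Theta\big(\theta_t-\alpha_{t}\,\beta\, G_t\big),\qquad \alpha_t=\min\big(1,\tau_{\theta_t}/\|G_t\|\big),$$ where, given $\theta_0,\dots,\theta_t$, the sample $G_t$ has distribution $\mathcal D(\theta_t)$. Assume $$\kappa:=p\mu-(1-p)^{-1/q}A_q(1-p)>0,\qquad \beta<\frac14\,\frac{\kappa}{\mu^2+6L^2},\qquad p\ge 1-(\beta\mu)^{\frac{q}{2(q-1)}}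 .$$ **Claim.** There are $\rho\in[0,1)$ and $M<\infty$ (not depending on $\theta_0$, $T$, $\delta$) such that for every $\theta_0\in\mathbb R^d$, every $T\ge 0$ and every $\delta>0$ $$\mathbb P\Big(\|\theta_T-\theta^\star\|>4\sqrt{\overline B_q^2+\overline\tau^2}\,\sqrt{\tfrac{2\beta\log(e/\delta)}{p\mu}}\Big)\le\delta+\rho^T M\big(1+\|\theta_0-\theta^\star\|^2\big)\qquad(\ast)$$ (for $\delta>e$ the square root is read as $0$). Moreover, $(\ast)$ holds for every $T\ge0$ and $\delta>0$ with any constants $\rho,M$ that describe the convergence of the chain started at $\theta_0$ to an invariant distribution: whenever $\pi$ is an invariant probability measure of the chain and the total variation distance between the law of $\theta_T$ and $\pi$ is at most $M\rho^T(1+\|\theta_0-\theta^\star\|^2)$ for all $T\ge0$. -/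

import Mathlib

open MeasureTheory ProbabilityTheory
open scoped ENNReal

namespace QCSGD

noncomputable section

/-! ### The objective -/

/-- `f` is `L`-Lipschitz-smooth: it is differentiable and bounded above by its quadratic models. -/
def LipschitzSmooth {d : ℕ} (f : EuclideanSpace ℝ (Fin d) → ℝ) (L : ℝ) : Prop :=
  Differentiable ℝ f ∧
    ∀ x y, f y ≤ f x + inner ℝ (gradient f x) (y - x) + L / 2 * ‖x - y‖ ^ 2

/-- `f` is `μ`-strongly convex: it is differentiable and bounded below by its quadratic models. -/
def StronglyConvex {d : ℕ} (f : EuclideanSpace ℝ (Fin d) → ℝ) (μ : ℝ) : Prop :=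
  Differentiable ℝ f ∧
    ∀ x y, f x + inner ℝ (gradient f x) (y - x) + μ / 2 * ‖x - y‖ ^ 2 ≤ f y

/-! ### The gradient samples -/

/-- The gradient samples are unbiased: `D x`, the distribution of a gradient sample at `x`,
has mean `∇ f x`. -/
def Unbiased {d : ℕ} (f : EuclideanSpace ℝ (Fin d) → ℝ)
    (D : Kernel (EuclideanSpace ℝ (Fin d)) (EuclideanSpace ℝ (Fin d))) : Prop :=
  ∀ x, Integrable (fun g => g) (D x) ∧ ∫ g, g ∂(D x) = gradient f x

/-- The distribution of the noise `g - ∇ f x`, for `g` distributed as `D x`. -/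
def noiseLaw {d : ℕ} (f : EuclideanSpace ℝ (Fin d) → ℝ)
    (D : Kernel (EuclideanSpace ℝ (Fin d)) (EuclideanSpace ℝ (Fin d)))
    (x : EuclideanSpace ℝ (Fin d)) : Measure (EuclideanSpace ℝ (Fin d)) :=
  (D x).map (fun g => g - gradient f x)

/-- The noise is diffuse: its distribution is a mixture `w • ν₁ + (1 - w) • ν₂` with `w > 0`, where
`ν₁` has a Lebesgue density which is bounded away from zero on every ball around the origin,
uniformly in the parameter `x`. -/
def DiffuseNoise {d : ℕ} (f : EuclideanSpace ℝ (Fin d) → ℝ)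
    (D : Kernel (EuclideanSpace ℝ (Fin d)) (EuclideanSpace ℝ (Fin d))) : Prop :=
  ∃ w : ℝ, 0 < w ∧ w ≤ 1 ∧ ∃ c : ℝ → ℝ, (∀ R > 0, 0 < c R) ∧
    ∀ x, ∃ (ν₁ ν₂ : Measure (EuclideanSpace ℝ (Fin d))) (h : EuclideanSpace ℝ (Fin d) → ℝ≥0∞),
      IsProbabilityMeasure ν₁ ∧ IsProbabilityMeasure ν₂ ∧
      noiseLaw f D x = ENNReal.ofReal w • ν₁ + ENNReal.ofReal (1 - w) • ν₂ ∧
      Measurable h ∧ ν₁ = volume.withDensity h ∧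
      ∀ R > 0, ENNReal.ofReal (c R) < ⨅ u ∈ Metric.closedBall (0 : EuclideanSpace ℝ (Fin d)) R, h u

/-- The `L^q` norm of the noise at `x` is at most `A * ‖x - xs‖ + B`. -/
def NoiseMoment {d : ℕ} (f : EuclideanSpace ℝ (Fin d) → ℝ)
    (D : Kernel (EuclideanSpace ℝ (Fin d)) (EuclideanSpace ℝ (Fin d)))
    (xs : EuclideanSpace ℝ (Fin d)) (q A B : ℝ) : Prop :=
  ∀ x, eLpNorm (fun g => g - gradient f x) (ENNReal.ofReal q) (D x)
    ≤ ENNReal.ofReal (A * ‖x - xs‖ + B)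

/-! ### Clipping at a quantile, and projection -/

/-- The `p`-th quantile of a probability distribution on the real line. -/
def quantile (p : ℝ) (m : Measure ℝ) : ℝ :=
  sInf {t : ℝ | p ≤ m.real (Set.Iic t)}

/-- The clipping threshold `τ_x`: the `p`-th quantile of the norm of a gradient sample at `x`. -/
def threshold {d : ℕ} (D : Kernel (EuclideanSpace ℝ (Fin d)) (EuclideanSpace ℝ (Fin d)))
    (p : ℝ) (x : EuclideanSpace ℝ (Fin d)) : ℝ :=
  quantile p ((D x).map (fun g => ‖g‖))

/-- The clipping factor `min (1, τ / ‖g‖)`. It only ever multiplies `g`, so that its value at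
`g = 0` is immaterial. -/
def clipFactor {d : ℕ} (τ : ℝ) (g : EuclideanSpace ℝ (Fin d)) : ℝ :=
  min 1 (τ / ‖g‖)

open Classical in
/-- The projection onto `S`: a point of `S` nearest to `x`. It exists and is unique if `S` is
nonempty, closed and convex. -/
def proj {d : ℕ} (S : Set (EuclideanSpace ℝ (Fin d))) (x : EuclideanSpace ℝ (Fin d)) :
    EuclideanSpace ℝ (Fin d) :=
  if h : ∃ y ∈ S, ∀ z ∈ S, ‖x - y‖ ≤ ‖x - z‖ then h.choose else x

/-- One step of projected quantile-clipped SGD from `x` with gradient sample `g`. -/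
def step {d : ℕ} (D : Kernel (EuclideanSpace ℝ (Fin d)) (EuclideanSpace ℝ (Fin d)))
    (S : Set (EuclideanSpace ℝ (Fin d))) (p β : ℝ) (x g : EuclideanSpace ℝ (Fin d)) :
    EuclideanSpace ℝ (Fin d) :=
  proj S (x - (clipFactor (threshold D p x) g * β) • g)

/-- `θ` are iterates of projected quantile-clipped SGD (without corruption) started at `θ₀`, with
gradient samples `G`: given `θ 0, …, θ t`, the sample `G t` has distribution `D (θ t)`. -/
structure IsIterates {d : ℕ} {Ω : Type*} [MeasurableSpace Ω] (P : Measure Ω)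
    (D : Kernel (EuclideanSpace ℝ (Fin d)) (EuclideanSpace ℝ (Fin d)))
    (S : Set (EuclideanSpace ℝ (Fin d))) (p β : ℝ) (θ₀ : EuclideanSpace ℝ (Fin d))
    (θ G : ℕ → Ω → EuclideanSpace ℝ (Fin d)) : Prop where
  measurable_grad : ∀ t, Measurable (G t)
  zero : ∀ ω, θ 0 ω = θ₀
  succ : ∀ t ω, θ (t + 1) ω = step D S p β (θ t ω) (G t ω)
  condLaw : ∀ t, HasCondDistrib (G t) (fun ω (s : Finset.Iic t) => θ s ω)
    (D.comap (fun x : Finset.Iic t → EuclideanSpace ℝ (Fin d) => x ⟨t, Finset.mem_Iic.2 le_rfl⟩)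
      (measurable_pi_apply _)) P

/-- The Markov transition kernel of projected quantile-clipped SGD (without corruption). The step is
jointly measurable by `measurable_step` below. -/
def transition {d : ℕ} (D : Kernel (EuclideanSpace ℝ (Fin d)) (EuclideanSpace ℝ (Fin d)))
    (S : Set (EuclideanSpace ℝ (Fin d))) (p β : ℝ) :
    Kernel (EuclideanSpace ℝ (Fin d)) (EuclideanSpace ℝ (Fin d)) :=
  (Kernel.id ×ₖ D).map (fun z => step D S p β z.1 z.2)

/-- The total variation distance of two probability measures. -/
def tvDist {α : Type*} [MeasurableSpace α] (m n : Measure α) : ℝ :=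
  ⨆ A : {A : Set α // MeasurableSet A}, |m.real A.1 - n.real A.1|

/-! ### Constants -/

/-- The constant `κ = p μ - (1 - p)^(-1/q) A (1 - p)` of the uncorrupted case. -/
def kappa (p q μ A : ℝ) : ℝ := p * μ - (1 - p) ^ (-(1 / q)) * A * (1 - p)

/-- `B̄ = A D + B`, with `D` the diameter of `S`. -/
def Bbar {d : ℕ} (S : Set (EuclideanSpace ℝ (Fin d))) (A B : ℝ) : ℝ := A * Metric.diam S + B

/-- `τ̄`, the supremum of the clipping thresholds over `S`. -/
def tauBar {d : ℕ} (D : Kernel (EuclideanSpace ℝ (Fin d)) (EuclideanSpace ℝ (Fin d)))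
    (S : Set (EuclideanSpace ℝ (Fin d))) (p : ℝ) : ℝ :=
  sSup (threshold D p '' S)

/-- The deviation `4 √(B̄² + τ̄²) √(2 β log (e / δ) / (p μ))`. -/
def deviation {d : ℕ} (D : Kernel (EuclideanSpace ℝ (Fin d)) (EuclideanSpace ℝ (Fin d)))
    (S : Set (EuclideanSpace ℝ (Fin d))) (p β μ A B δ : ℝ) : ℝ :=
  4 * √(Bbar S A B ^ 2 + tauBar D S p ^ 2) *
    √(2 * β * Real.log (Real.exp 1 / δ) / (p * μ))

/-! ### The step is well defined and measurable -/

theorem proj_spec {d : ℕ} {S : Set (EuclideanSpace ℝ (Fin d))} (hne : S.Nonempty)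
    (hcl : IsClosed S) (x : EuclideanSpace ℝ (Fin d)) :
    proj S x ∈ S ∧ ∀ z ∈ S, ‖x - proj S x‖ ≤ ‖x - z‖ := by
  have h : ∃ y ∈ S, ∀ z ∈ S, ‖x - y‖ ≤ ‖x - z‖ := by
    obtain ⟨y, hy, hxy⟩ := hcl.exists_infDist_eq_dist hne x
    refine ⟨y, hy, fun z hz => ?_⟩
    rw [← dist_eq_norm, ← dist_eq_norm, ← hxy]
    exact Metric.infDist_le_dist_of_mem hz
  unfold proj
  rw [dif_pos h]
  exact h.choose_spec

theorem inner_proj_nonpos {d : ℕ} {S : Set (EuclideanSpace ℝ (Fin d))} (hne : S.Nonempty)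
    (hcl : IsClosed S) (hcv : Convex ℝ S) (x : EuclideanSpace ℝ (Fin d)) :
    ∀ z ∈ S, inner ℝ (x - proj S x) (z - proj S x) ≤ 0 := by
  obtain ⟨hm, hle⟩ := proj_spec hne hcl x
  rw [← norm_eq_iInf_iff_real_inner_le_zero hcv hm]
  have : Nonempty S := hne.to_subtype
  apply le_antisymm
  · exact le_ciInf fun w => hle w w.2
  · exact ciInf_le ⟨0, by rintro _ ⟨w, rfl⟩; exact norm_nonneg _⟩ (⟨proj S x, hm⟩ : S)

theorem norm_proj_sub_proj_le {d : ℕ} {S : Set (EuclideanSpace ℝ (Fin d))} (hne : S.Nonempty)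
    (hcl : IsClosed S) (hcv : Convex ℝ S) (x y : EuclideanSpace ℝ (Fin d)) :
    ‖proj S x - proj S y‖ ≤ ‖x - y‖ := by
  have h1 := inner_proj_nonpos hne hcl hcv x _ (proj_spec hne hcl y).1
  have h2 := inner_proj_nonpos hne hcl hcv y _ (proj_spec hne hcl x).1
  set a := proj S x
  set b := proj S y
  have key : inner ℝ (a - b) (a - b) ≤ inner ℝ (x - y) (a - b) := by
    simp only [inner_sub_left, inner_sub_right] at h1 h2 ⊢
    linarith
  rw [real_inner_self_eq_norm_mul_norm] at key
  have h3 := real_inner_le_norm (x - y) (a - b)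
  by_contra hlt
  push Not at hlt
  have : 0 < ‖a - b‖ := lt_of_le_of_lt (norm_nonneg _) hlt
  nlinarith

theorem measurable_proj {d : ℕ} {S : Set (EuclideanSpace ℝ (Fin d))} (hne : S.Nonempty)
    (hcl : IsClosed S) (hcv : Convex ℝ S) : Measurable (proj S) := by
  have : LipschitzWith 1 (proj S) := LipschitzWith.of_dist_le_mul fun x y => by
    simpa [dist_eq_norm] using norm_proj_sub_proj_le hne hcl hcv x y
  exact this.continuous.measurable

theorem measurable_threshold {d : ℕ}
    (D : Kernel (EuclideanSpace ℝ (Fin d)) (EuclideanSpace ℝ (Fin d))) [IsMarkovKernel D]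
    {p : ℝ} (hp0 : 0 < p) (hp1 : p < 1) : Measurable (threshold D p) := by
  have hF : ∀ x t, ((D x).map (fun g => ‖g‖)).real (Set.Iic t) = (D x).real {g | ‖g‖ ≤ t} := by
    intro x t
    rw [map_measureReal_apply measurable_norm measurableSet_Iic]
    rfl
  refine measurable_of_Iio fun t => ?_
  have : threshold D p ⁻¹' Set.Iio t
      = ⋃ r : {r : ℚ // (r : ℝ) < t}, {x | p ≤ (D x).real {g | ‖g‖ ≤ (r.1 : ℝ)}} := by
    ext x
    have : IsProbabilityMeasure ((D x).map (fun g => ‖g‖)) :=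
      Measure.isProbabilityMeasure_map measurable_norm.aemeasurable
    have hbdd : BddBelow {t : ℝ | p ≤ ((D x).map (fun g => ‖g‖)).real (Set.Iic t)} := by
      refine ⟨0, fun s hs => ?_⟩
      by_contra hneg
      push Not at hneg
      have h0 : {g : EuclideanSpace ℝ (Fin d) | ‖g‖ ≤ s} = ∅ := by
        ext g
        simp only [Set.mem_ofPred_eq, Set.mem_empty_iff_false, iff_false, not_le]
        exact lt_of_lt_of_le hneg (norm_nonneg g)
      simp only [Set.mem_ofPred_eq, hF, h0, measureReal_empty] at hs
      linarith
    have hnon : {t : ℝ | p ≤ ((D x).map (fun g => ‖g‖)).real (Set.Iic t)}.Nonempty := by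
      have := tendsto_cdf_atTop ((D x).map (fun g => ‖g‖))
      obtain ⟨s, hs⟩ := (this.eventually (lt_mem_nhds hp1)).exists
      exact ⟨s, by rw [cdf_eq_real] at hs; exact hs.le⟩
    simp only [Set.mem_preimage, Set.mem_Iio, Set.mem_iUnion, Set.mem_ofPred_eq, threshold, quantile]
    rw [csInf_lt_iff hbdd hnon]
    constructor
    · rintro ⟨s, hs, hst⟩
      obtain ⟨r, hr1, hr2⟩ := exists_rat_btwn hst
      refine ⟨⟨r, hr2⟩, ?_⟩
      rw [← hF]
      exact le_trans hs (measureReal_mono (Set.Iic_subset_Iic.2 hr1.le))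
    · rintro ⟨⟨r, hr⟩, h⟩
      exact ⟨r, by rw [Set.mem_ofPred_eq, hF]; exact h, hr⟩
  rw [this]
  refine MeasurableSet.iUnion fun r => ?_
  refine measurableSet_le measurable_const ?_
  exact (D.measurable_coe (measurableSet_le measurable_norm measurable_const)).ennreal_toReal

theorem measurable_step {d : ℕ}
    (D : Kernel (EuclideanSpace ℝ (Fin d)) (EuclideanSpace ℝ (Fin d))) [IsMarkovKernel D]
    {S : Set (EuclideanSpace ℝ (Fin d))} (hne : S.Nonempty) (hcl : IsClosed S) (hcv : Convex ℝ S)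
    {p : ℝ} (hp0 : 0 < p) (hp1 : p < 1) (β : ℝ) :
    Measurable (fun z : EuclideanSpace ℝ (Fin d) × EuclideanSpace ℝ (Fin d) =>
      step D S p β z.1 z.2) := by
  have hτ : Measurable (fun z : EuclideanSpace ℝ (Fin d) × EuclideanSpace ℝ (Fin d) =>
      threshold D p z.1) := (measurable_threshold D hp0 hp1).comp measurable_fst
  have hα : Measurable (fun z : EuclideanSpace ℝ (Fin d) × EuclideanSpace ℝ (Fin d) =>
      clipFactor (threshold D p z.1) z.2 * β) :=
    (measurable_const.min (hτ.div measurable_snd.norm)).mul_const β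
  have hs : Measurable (fun z : EuclideanSpace ℝ (Fin d) × EuclideanSpace ℝ (Fin d) =>
      z.1 - (clipFactor (threshold D p z.1) z.2 * β) • z.2) :=
    measurable_fst.sub (hα.smul measurable_snd)
  exact (measurable_proj hne hcl hcv).comp hs

end

end QCSGD

namespace QCSGD

variable {d : ℕ}

/-! ### The clipping threshold -/

section Threshold

variable (D : Kernel (EuclideanSpace ℝ (Fin d)) (EuclideanSpace ℝ (Fin d))) {p : ℝ}
  (x : EuclideanSpace ℝ (Fin d))

/-! The argument runs on the Lyapunov function `exp (lam * ‖x - θs‖ ^ 2)`, with `lam` chosen so that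
`lam * deviation ^ 2 = log (e / δ)`. Once its expectation is at most `e`, Markov's inequality is
exactly the stated tail bound.

For the drift, write `r = ‖x - θs‖` and let `X` be the inner product of the clipped sample with `x -
θs`. Nonexpansiveness of the projection bounds the new squared distance by `r ^ 2 - 2 * β * X + β ^
2 * τ ^ 2`. The mean of `X` is at least `p * μ * r ^ 2 - √(β * μ) * b * r` with `b = Bbar S A B`
(`le_integral_inner_clipFactor_smul`, `rpow_le_sqrt_of_quantile`): samples below the quantile keep a
fraction `p` of the strong convexity, and the bias from clipping lives on an event of mass at most
`1 - p`. Since `|X| ≤ τ * r`, Hoeffding's lemma controls the fluctuations (`lintegral_exp_step_le`),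
and their cost, of order `r ^ 2`, is absorbed by the contraction (`exponent_le`).

By Jensen's inequality the logarithm of the exponential moment then obeys `y ↦ a * y + (1 - a) / 8`
with `a = 1 - β * p * μ / 2`. It falls below `1` after a burn-in time `N` that is uniform in the
initial law, because one step leads into the bounded set `S`. The first claim follows by making the
error term at least `1` before time `N`. An invariant law is a constant solution of the same
recursion, so it satisfies the tail bound at once, and the second claim costs one total variation
distance. -/

theorem threshold_eq_sInf :
    threshold D p x = sInf {t : ℝ | p ≤ (D x).real {g | ‖g‖ ≤ t}} := by
  unfold threshold quantile
  congr 1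
  ext t
  rw [Set.mem_ofPred_eq, Set.mem_ofPred_eq, map_measureReal_apply measurable_norm measurableSet_Iic]
  rfl

theorem nonneg_of_le_measureReal (hp0 : 0 < p) {t : ℝ}
    (ht : p ≤ (D x).real {g | ‖g‖ ≤ t}) : 0 ≤ t := by
  by_contra! hneg
  have h0 : {g : EuclideanSpace ℝ (Fin d) | ‖g‖ ≤ t} = ∅ := by
    ext g
    simpa using hneg.trans_le (norm_nonneg g)
  rw [h0, measureReal_empty] at ht
  linarith

theorem threshold_nonneg (hp0 : 0 < p) : 0 ≤ threshold D p x := by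
  rw [threshold_eq_sInf]
  exact Real.sInf_nonneg fun t ht => nonneg_of_le_measureReal D x hp0 ht

theorem threshold_le (hp0 : 0 < p) {t : ℝ} (ht : p ≤ (D x).real {g | ‖g‖ ≤ t}) :
    threshold D p x ≤ t := by
  rw [threshold_eq_sInf]
  exact csInf_le ⟨0, fun s hs => nonneg_of_le_measureReal D x hp0 hs⟩ ht

/-- The infimum defining the quantile is attained, by right continuity of the distribution function.
-/
theorem le_measureReal_norm_le_threshold [IsMarkovKernel D] (hp1 : p < 1) :
    p ≤ (D x).real {g | ‖g‖ ≤ threshold D p x} := by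
  set m := (D x).map (fun g => ‖g‖)
  have : IsProbabilityMeasure m := Measure.isProbabilityMeasure_map measurable_norm.aemeasurable
  have hF : ∀ t, cdf m t = (D x).real {g | ‖g‖ ≤ t} := by
    intro t
    rw [cdf_eq_real, map_measureReal_apply measurable_norm measurableSet_Iic]
    rfl
  have hne : {t : ℝ | p ≤ (D x).real {g | ‖g‖ ≤ t}}.Nonempty := by
    obtain ⟨s, hs⟩ := ((tendsto_cdf_atTop m).eventually (lt_mem_nhds hp1)).exists
    exact ⟨s, by rw [hF] at hs; exact hs.le⟩
  have hlt : ∀ s, threshold D p x < s → p ≤ cdf m s := by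
    intro s hs
    rw [threshold_eq_sInf] at hs
    obtain ⟨t, ht, hts⟩ := exists_lt_of_csInf_lt hne hs
    rw [Set.mem_ofPred_eq, ← hF] at ht
    exact ht.trans (monotone_cdf m hts.le)
  rw [← hF]
  have hc : Filter.Tendsto (cdf m) (nhdsWithin (threshold D p x) (Set.Ioi (threshold D p x)))
      (nhds (cdf m (threshold D p x))) :=
    ((cdf m).right_continuous _).mono_left (nhdsWithin_mono _ Set.Ioi_subset_Ici_self)
  exact ge_of_tendsto hc (Filter.eventually_of_mem self_mem_nhdsWithin fun s hs => hlt s hs)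

theorem measureReal_threshold_lt_norm_le [IsMarkovKernel D] (hp1 : p < 1) :
    (D x).real {g | threshold D p x < ‖g‖} ≤ 1 - p := by
  have h := le_measureReal_norm_le_threshold D x hp1
  have hm : MeasurableSet {g : EuclideanSpace ℝ (Fin d) | ‖g‖ ≤ threshold D p x} :=
    measurableSet_le measurable_norm measurable_const
  have hc : {g : EuclideanSpace ℝ (Fin d) | threshold D p x < ‖g‖}
      = {g | ‖g‖ ≤ threshold D p x}ᶜ := by
    ext g; simp
  rw [hc, probReal_compl_eq_one_sub hm]
  linarith

end Threshold

theorem norm_clipFactor_smul_le {τ : ℝ} (hτ : 0 ≤ τ) (g : EuclideanSpace ℝ (Fin d)) :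
    ‖clipFactor τ g • g‖ ≤ τ := by
  have h0 : 0 ≤ clipFactor τ g := le_min zero_le_one (by positivity)
  rw [norm_smul, Real.norm_of_nonneg h0]
  -- For `g = 0` the factor is the default value `min 1 (τ / 0) = 0`, so this case is separate.
  rcases (norm_nonneg g).eq_or_lt with hg | hg
  · rw [← hg, mul_zero]; exact hτ
  · calc clipFactor τ g * ‖g‖ ≤ τ / ‖g‖ * ‖g‖ := by
          gcongr; exact min_le_right _ _
      _ = τ := by field_simp

/-! ### The objective -/

section Objective

variable {f : EuclideanSpace ℝ (Fin d) → ℝ} {L μ : ℝ} {θs : EuclideanSpace ℝ (Fin d)}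

theorem LipschitzSmooth.mono {L' : ℝ} (hf : LipschitzSmooth f L) (h : L ≤ L') :
    LipschitzSmooth f L' :=
  ⟨hf.1, fun x y => (hf.2 x y).trans (by gcongr)⟩

theorem gradient_eq_zero_of_forall_le (hθs : ∀ x, f θs ≤ f x) : gradient f θs = 0 := by
  have h : IsLocalMin f θs := Filter.Eventually.of_forall hθs
  rw [gradient, h.fderiv_eq_zero, map_zero]

/-- A gradient step of length `1 / L` lowers `f` by at least `‖∇f x‖ ^ 2 / (2 * L)`, while `f x`
exceeds the minimum by at most `L / 2 * ‖x - θs‖ ^ 2`. -/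
theorem LipschitzSmooth.norm_gradient_le (hf : LipschitzSmooth f L) (hL : 0 < L)
    (hθs : ∀ x, f θs ≤ f x) (x : EuclideanSpace ℝ (Fin d)) :
    ‖gradient f x‖ ≤ L * ‖x - θs‖ := by
  have h1 := hf.2 θs x
  rw [gradient_eq_zero_of_forall_le hθs, inner_zero_left, norm_sub_rev θs x] at h1
  have h2 := (hθs _).trans (hf.2 x (x - L⁻¹ • gradient f x))
  rw [sub_sub_cancel_left, inner_neg_right, inner_smul_right, real_inner_self_eq_norm_sq,
    sub_sub_cancel, norm_smul, Real.norm_of_nonneg (inv_nonneg.2 hL.le)] at h2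
  have h3 : -(L⁻¹ * ‖gradient f x‖ ^ 2) + L / 2 * (L⁻¹ * ‖gradient f x‖) ^ 2
      = -(‖gradient f x‖ ^ 2 / (2 * L)) := by
    field_simp; ring
  have h4 : ‖gradient f x‖ ^ 2 / (2 * L) ≤ L / 2 * ‖x - θs‖ ^ 2 := by linarith
  rw [div_le_iff₀ (by positivity)] at h4
  refine abs_le_of_sq_le_sq' ?_ (by positivity) |>.2
  linarith [h4, mul_pow L ‖x - θs‖ 2]

/-- Sum of the quadratic lower bounds from `θs` to `x` and from `x` to `θs`, each contributing `μ /
2`. -/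
theorem StronglyConvex.le_inner_gradient (hf : StronglyConvex f μ) (hθs : ∀ x, f θs ≤ f x)
    (x : EuclideanSpace ℝ (Fin d)) : μ * ‖x - θs‖ ^ 2 ≤ inner ℝ (gradient f x) (x - θs) := by
  have h1 := hf.2 θs x
  have h2 := hf.2 x θs
  rw [gradient_eq_zero_of_forall_le hθs, inner_zero_left, norm_sub_rev θs x] at h1
  rw [← neg_sub x θs, inner_neg_right] at h2
  linarith

end Objective

/-! ### The noise -/

section Noise

variable {f : EuclideanSpace ℝ (Fin d) → ℝ} {θs : EuclideanSpace ℝ (Fin d)}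
  {D : Kernel (EuclideanSpace ℝ (Fin d)) (EuclideanSpace ℝ (Fin d))} {p q A B : ℝ}

/-- Hölder's inequality on `E` between the `L^1` and `L^q` norms of the noise. -/
theorem NoiseMoment.setIntegral_norm_le [IsMarkovKernel D] (hD : NoiseMoment f D θs q A B)
    (hunb : Unbiased f D) (hq : 1 < q) (hA : 0 ≤ A) (hB : 0 < B)
    (x : EuclideanSpace ℝ (Fin d)) (E : Set (EuclideanSpace ℝ (Fin d))) :
    ∫ g in E, ‖g - gradient f x‖ ∂(D x)
      ≤ (A * ‖x - θs‖ + B) * (D x).real E ^ (1 - 1 / q) := by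
  have hm : AEStronglyMeasurable (fun g => g - gradient f x) ((D x).restrict E) := by fun_prop
  have hi : Integrable (fun g => g - gradient f x) ((D x).restrict E) :=
    ((hunb x).1.sub (integrable_const _)).integrableOn
  have hq' : (1 : ℝ≥0∞) ≤ ENNReal.ofReal q := by
    rw [← ENNReal.ofReal_one]; exact ENNReal.ofReal_le_ofReal hq.le
  have h := eLpNorm_le_eLpNorm_mul_rpow_measure_univ hq' hm
  have h2 : eLpNorm (fun g => g - gradient f x) (ENNReal.ofReal q) ((D x).restrict E)
      ≤ ENNReal.ofReal (A * ‖x - θs‖ + B) :=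
    (eLpNorm_mono_measure _ Measure.restrict_le_self).trans (hD x)
  have hAB : 0 ≤ A * ‖x - θs‖ + B := by positivity
  have hq1 : 0 ≤ 1 - 1 / q := by
    rw [sub_nonneg, div_le_one (by linarith)]; exact hq.le
  rw [Measure.restrict_apply_univ, ENNReal.toReal_one, ENNReal.toReal_ofReal (by linarith),
    div_one] at h
  rw [integral_norm_eq_lintegral_enorm hm, ← eLpNorm_one_eq_lintegral_enorm]
  calc (eLpNorm (fun g => g - gradient f x) 1 ((D x).restrict E)).toReal
      ≤ (ENNReal.ofReal (A * ‖x - θs‖ + B) * (D x) E ^ (1 - 1 / q)).toReal := by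
        refine ENNReal.toReal_mono ?_ (h.trans (by gcongr))
        exact ENNReal.mul_ne_top ENNReal.ofReal_ne_top
          (ENNReal.rpow_ne_top_of_nonneg hq1 (measure_ne_top _ _))
    _ = _ := by
        rw [ENNReal.toReal_mul, ENNReal.toReal_ofReal hAB, ← ENNReal.toReal_rpow]
        rfl

/-- Markov's inequality for `‖g‖`: at the level on the right, the upper tail has mass at most `1 -
p`. -/
theorem threshold_le_div [IsMarkovKernel D] (hD : NoiseMoment f D θs q A B)
    (hunb : Unbiased f D) (hq : 1 < q) (hA : 0 ≤ A) (hB : 0 < B) (hp0 : 0 < p) (hp1 : p < 1)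
    (x : EuclideanSpace ℝ (Fin d)) :
    threshold D p x ≤ (A * ‖x - θs‖ + B + ‖gradient f x‖) / (1 - p) := by
  set t := (A * ‖x - θs‖ + B + ‖gradient f x‖) / (1 - p) with ht
  have hp' : 0 < 1 - p := by linarith
  have ht0 : 0 < t := by positivity
  have h1 := hD.setIntegral_norm_le hunb hq hA hB x Set.univ
  rw [setIntegral_univ, probReal_univ, Real.one_rpow, mul_one] at h1
  have hi := (hunb x).1
  have h2 : ∫ g, ‖g‖ ∂(D x) ≤ A * ‖x - θs‖ + B + ‖gradient f x‖ := by
    calc ∫ g, ‖g‖ ∂(D x) ≤ ∫ g, (‖g - gradient f x‖ + ‖gradient f x‖) ∂(D x) := by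
          refine integral_mono hi.norm
            ((hi.sub (integrable_const _)).norm.add (integrable_const _)) fun g => ?_
          simpa using norm_add_le (g - gradient f x) (gradient f x)
      _ = ∫ g, ‖g - gradient f x‖ ∂(D x) + ‖gradient f x‖ := by
          have hi' : Integrable (fun g => ‖g - gradient f x‖) (D x) :=
            (hi.sub (integrable_const _)).norm
          rw [integral_add hi' (integrable_const _)]
          simp
      _ ≤ _ := by gcongr
  have h3 := mul_meas_ge_le_integral_of_nonneg
    (Filter.Eventually.of_forall fun g : EuclideanSpace ℝ (Fin d) => norm_nonneg g) hi.norm t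
  apply threshold_le D x hp0
  have hm : MeasurableSet {g : EuclideanSpace ℝ (Fin d) | ‖g‖ ≤ t} :=
    measurableSet_le measurable_norm measurable_const
  have h4 := probReal_compl_eq_one_sub (μ := D x) hm
  have h5 : (D x).real {g | ‖g‖ ≤ t}ᶜ ≤ (D x).real {g | t ≤ ‖g‖} :=
    measureReal_mono fun g hg => by
      simp only [Set.mem_compl_iff, Set.mem_ofPred_eq, not_le] at hg ⊢
      exact hg.le
  have h6 : t * (D x).real {g | t ≤ ‖g‖} ≤ t * (1 - p) := by
    refine h3.trans (h2.trans_eq ?_)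
    rw [ht]; field_simp
  have h7 := le_of_mul_le_mul_left h6 ht0
  linarith

/-- Makes `tauBar` a genuine supremum; on an unbounded set `sSup` would be the default value `0`. -/
theorem bddAbove_threshold {L : ℝ} [IsMarkovKernel D] (hD : NoiseMoment f D θs q A B)
    (hunb : Unbiased f D) (hf : LipschitzSmooth f L) (hθs : ∀ x, f θs ≤ f x)
    (hq : 1 < q) (hA : 0 ≤ A) (hB : 0 < B) (hp0 : 0 < p) (hp1 : p < 1)
    {S : Set (EuclideanSpace ℝ (Fin d))} (hSb : Bornology.IsBounded S) (hθS : θs ∈ S) :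
    BddAbove (threshold D p '' S) := by
  have hp' : 0 < 1 - p := by linarith
  refine ⟨(A * Metric.diam S + B + max L 1 * Metric.diam S) / (1 - p), ?_⟩
  rintro _ ⟨x, hx, rfl⟩
  have hr : ‖x - θs‖ ≤ Metric.diam S := by
    rw [← dist_eq_norm]; exact Metric.dist_le_diam_of_mem hSb hx hθS
  -- `L` carries no sign assumption (in dimension `0` it may be negative), so it is enlarged to a
  -- positive constant.
  have hL : 0 < max L 1 := lt_max_of_lt_right one_pos
  refine (threshold_le_div hD hunb hq hA hB hp0 hp1 x).trans ?_
  have := (hf.mono (le_max_left L 1)).norm_gradient_le hL hθs x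
  gcongr
  exact this.trans (by gcongr)

end Noise

end QCSGD

namespace QCSGD

variable {d : ℕ}

/-! ### One step of the chain -/

section Step

variable {f : EuclideanSpace ℝ (Fin d) → ℝ} {θs : EuclideanSpace ℝ (Fin d)}
  {D : Kernel (EuclideanSpace ℝ (Fin d)) (EuclideanSpace ℝ (Fin d))} {p q A B μ : ℝ}

theorem measurable_clipFactor_smul (τ : ℝ) :
    Measurable (fun g : EuclideanSpace ℝ (Fin d) => clipFactor τ g • g) := by
  have : Measurable (fun g : EuclideanSpace ℝ (Fin d) => clipFactor τ g) :=
    measurable_const.min (measurable_const.div measurable_norm)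
  exact this.smul measurable_id

/-- Clipping leaves small gradient samples alone, and shrinks the others. -/
theorem le_inner_clipFactor_smul {τ : ℝ} (hτ : 0 ≤ τ) (v u g : EuclideanSpace ℝ (Fin d))
    (huv : 0 ≤ inner ℝ v u) :
    Set.indicator {g | ‖g‖ ≤ τ} (fun _ => inner ℝ v u) g + inner ℝ (g - v) u
        - Set.indicator {g | τ < ‖g‖} (fun g => ‖g - v‖ * ‖u‖) g
      ≤ inner ℝ (clipFactor τ g • g) u := by
  rcases le_or_gt ‖g‖ τ with hg | hg
  · have h1 : clipFactor τ g • g = g := by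
      rcases eq_or_ne g 0 with rfl | h0
      · simp
      · have : 1 ≤ τ / ‖g‖ := by rwa [one_le_div (norm_pos_iff.2 h0)]
        rw [clipFactor, min_eq_left this, one_smul]
    rw [Set.indicator_of_mem (show g ∈ {g | ‖g‖ ≤ τ} from hg),
      Set.indicator_of_notMem (show g ∉ {g | τ < ‖g‖} from hg.not_gt), h1, inner_sub_left]
    linarith
  · rw [Set.indicator_of_notMem (show g ∉ {g | ‖g‖ ≤ τ} from hg.not_ge),
      Set.indicator_of_mem (show g ∈ {g | τ < ‖g‖} from hg), real_inner_smul_left]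
    have h0 : 0 ≤ clipFactor τ g := le_min zero_le_one (by positivity)
    have h1 : clipFactor τ g ≤ 1 := min_le_left _ _
    have h2 := real_inner_le_norm (g - v) u
    have h3 : inner ℝ g u = inner ℝ (g - v) u + inner ℝ v u := by rw [inner_sub_left]; ring
    -- On a clipped sample the signal `inner v u ≥ 0` is discarded, and the part of the noise
    -- removed by clipping is bounded by Cauchy–Schwarz.
    have h4 : (1 - clipFactor τ g) * inner ℝ (g - v) u ≤ 1 * (‖g - v‖ * ‖u‖) :=
      calc (1 - clipFactor τ g) * inner ℝ (g - v) u
          ≤ (1 - clipFactor τ g) * (‖g - v‖ * ‖u‖) := by gcongr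
        _ ≤ _ := by gcongr; linarith
    rw [h3]
    nlinarith [mul_nonneg h0 huv]

/-- Integrate the pointwise bound: the unclipped event has mass at least `p`, the unrestricted noise
term has mean zero, and the remaining noise sits on an event of mass at most `1 - p`, whence the
Hölder factor. -/
theorem le_integral_inner_clipFactor_smul [IsMarkovKernel D] (hD : NoiseMoment f D θs q A B)
    (hunb : Unbiased f D) (hf : StronglyConvex f μ) (hμ : 0 < μ) (hθs : ∀ x, f θs ≤ f x)
    (hq : 1 < q) (hA : 0 ≤ A) (hB : 0 < B) (hp0 : 0 < p) (hp1 : p < 1)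
    (x : EuclideanSpace ℝ (Fin d)) :
    p * μ * ‖x - θs‖ ^ 2 - (1 - p) ^ (1 - 1 / q) * (A * ‖x - θs‖ + B) * ‖x - θs‖
      ≤ ∫ g, inner ℝ (clipFactor (threshold D p x) g • g) (x - θs) ∂(D x) := by
  set τ := threshold D p x
  set u := x - θs
  set v := gradient f x
  have hτ : 0 ≤ τ := threshold_nonneg D x hp0
  have hvu : μ * ‖u‖ ^ 2 ≤ inner ℝ v u := hf.le_inner_gradient hθs x
  have hvu0 : 0 ≤ inner ℝ v u := le_trans (by positivity) hvu
  have hm1 : MeasurableSet {g : EuclideanSpace ℝ (Fin d) | ‖g‖ ≤ τ} :=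
    measurableSet_le measurable_norm measurable_const
  have hm2 : MeasurableSet {g : EuclideanSpace ℝ (Fin d) | τ < ‖g‖} :=
    measurableSet_lt measurable_const measurable_norm
  have hi := (hunb x).1
  have hε : Integrable (fun g => g - v) (D x) := hi.sub (integrable_const _)
  have i1 : Integrable (Set.indicator {g : EuclideanSpace ℝ (Fin d) | ‖g‖ ≤ τ}
      (fun _ => inner ℝ v u)) (D x) := (integrable_const _).indicator hm1
  have i2 : Integrable (fun g => inner ℝ (g - v) u) (D x) := hε.inner_const u
  have i3 : Integrable (Set.indicator {g : EuclideanSpace ℝ (Fin d) | τ < ‖g‖}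
      (fun g => ‖g - v‖ * ‖u‖)) (D x) := (hε.norm.mul_const _).indicator hm2
  have i4 : Integrable (fun g => inner ℝ (clipFactor τ g • g) u) (D x) := by
    refine Integrable.inner_const (Integrable.of_bound
      (measurable_clipFactor_smul τ).aestronglyMeasurable τ ?_) u
    exact Filter.Eventually.of_forall fun g => norm_clipFactor_smul_le hτ g
  have h := integral_mono ((i1.add i2).sub i3) i4
    fun g => le_inner_clipFactor_smul hτ v u g hvu0
  refine le_trans ?_ h
  have e2 : ∫ g, inner ℝ (g - v) u ∂(D x) = 0 := by
    have : ∫ g, (g - v) ∂(D x) = 0 := by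
      rw [integral_sub hi (integrable_const _), (hunb x).2]
      simp [v]
    simp_rw [fun g : EuclideanSpace ℝ (Fin d) => real_inner_comm u (g - v)]
    rw [integral_inner hε, this, inner_zero_right]
  have e : ∫ g, (Set.indicator {g | ‖g‖ ≤ τ} (fun _ => inner ℝ v u) g + inner ℝ (g - v) u
        - Set.indicator {g | τ < ‖g‖} (fun g => ‖g - v‖ * ‖u‖) g) ∂(D x)
      = (D x).real {g | ‖g‖ ≤ τ} * inner ℝ v u
        - (∫ g in {g | τ < ‖g‖}, ‖g - v‖ ∂(D x)) * ‖u‖ := by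
    have i12 : Integrable (fun g => Set.indicator {g | ‖g‖ ≤ τ} (fun _ => inner ℝ v u) g
      + inner ℝ (g - v) u) (D x) := i1.add i2
    rw [integral_sub i12 i3, integral_add i1 i2, e2,
      integral_indicator hm1, integral_indicator hm2, setIntegral_const, integral_mul_const,
      smul_eq_mul, add_zero]
  have h1 : p * (μ * ‖u‖ ^ 2) ≤ (D x).real {g | ‖g‖ ≤ τ} * inner ℝ v u := by
    gcongr
    exact le_measureReal_norm_le_threshold D x hp1
  have hq1 : 0 ≤ 1 - 1 / q := by
    rw [sub_nonneg, div_le_one (by linarith)]; exact hq.le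
  have h2 : ∫ g in {g | τ < ‖g‖}, ‖g - v‖ ∂(D x) ≤ (A * ‖u‖ + B) * (1 - p) ^ (1 - 1 / q) := by
    refine (hD.setIntegral_norm_le hunb hq hA hB x _).trans ?_
    gcongr
    exact measureReal_threshold_lt_norm_le D x hp1
  have h3 := mul_le_mul_of_nonneg_right h2 (norm_nonneg u)
  refine le_trans ?_ e.ge
  linarith

/-- The minimizer is fixed by the nonexpansive projection, so the projection can be dropped and the
square expanded. -/
theorem norm_step_sub_sq_le {S : Set (EuclideanSpace ℝ (Fin d))} (hScl : IsClosed S)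
    (hSc : Convex ℝ S) (hθS : θs ∈ S) (hp0 : 0 < p) (β : ℝ) (x g : EuclideanSpace ℝ (Fin d)) :
    ‖step D S p β x g - θs‖ ^ 2 ≤ ‖x - θs‖ ^ 2
      - 2 * β * inner ℝ (clipFactor (threshold D p x) g • g) (x - θs)
      + β ^ 2 * threshold D p x ^ 2 := by
  have hfix : proj S θs = θs := by
    have h := (proj_spec ⟨θs, hθS⟩ hScl θs).2 θs hθS
    rw [sub_self, norm_zero] at h
    exact (sub_eq_zero.1 (norm_eq_zero.1 (le_antisymm h (norm_nonneg _)))).symm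
  set τ := threshold D p x with hτ
  have h1 : ‖step D S p β x g - θs‖ ≤ ‖(x - θs) - β • (clipFactor τ g • g)‖ := by
    have h := norm_proj_sub_proj_le ⟨θs, hθS⟩ hScl hSc
      (x - (clipFactor τ g * β) • g) θs
    rw [hfix] at h
    refine h.trans_eq ?_
    congr 1
    rw [smul_smul, mul_comm β]
    abel
  have h2 : ‖clipFactor τ g • g‖ ≤ τ := norm_clipFactor_smul_le (threshold_nonneg D x hp0) g
  calc ‖step D S p β x g - θs‖ ^ 2 ≤ ‖(x - θs) - β • (clipFactor τ g • g)‖ ^ 2 := by gcongr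
    _ = ‖x - θs‖ ^ 2 - 2 * β * inner ℝ (clipFactor τ g • g) (x - θs)
        + β ^ 2 * ‖clipFactor τ g • g‖ ^ 2 := by
      rw [norm_sub_sq_real, real_inner_smul_right, norm_smul, mul_pow, Real.norm_eq_abs, sq_abs,
        real_inner_comm]
      ring
    _ ≤ _ := by gcongr

/-- Hoeffding's lemma for one step of the chain. -/
theorem lintegral_exp_step_le [IsMarkovKernel D] {S : Set (EuclideanSpace ℝ (Fin d))}
    (hScl : IsClosed S) (hSc : Convex ℝ S) (hθS : θs ∈ S) (hp0 : 0 < p) {β lam τ m : ℝ}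
    (hβ : 0 < β) (hlam : 0 < lam) (x : EuclideanSpace ℝ (Fin d)) (hτ : threshold D p x ≤ τ)
    (hm : m ≤ ∫ g, inner ℝ (clipFactor (threshold D p x) g • g) (x - θs) ∂(D x)) :
    ∫⁻ g, ENNReal.ofReal (Real.exp (lam * ‖step D S p β x g - θs‖ ^ 2)) ∂(D x)
      ≤ ENNReal.ofReal (Real.exp (lam * (‖x - θs‖ ^ 2 - 2 * β * m + β ^ 2 * τ ^ 2
        + 2 * β ^ 2 * lam * τ ^ 2 * ‖x - θs‖ ^ 2))) := by
  have hτ0 : 0 ≤ threshold D p x := threshold_nonneg D x hp0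
  have hτ0' : 0 ≤ τ := hτ0.trans hτ
  set r := ‖x - θs‖ with hr
  set X : EuclideanSpace ℝ (Fin d) → ℝ :=
    fun g => inner ℝ (clipFactor (threshold D p x) g • g) (x - θs) with hX
  have hXm : Measurable X :=
    (measurable_clipFactor_smul _).inner measurable_const
  have hXb : ∀ g, X g ∈ Set.Icc (-(τ * r)) (τ * r) := fun g => by
    rw [Set.mem_Icc, ← abs_le]
    exact (abs_real_inner_le_norm _ _).trans
      (mul_le_mul_of_nonneg_right ((norm_clipFactor_smul_le hτ0 g).trans hτ) (norm_nonneg _))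
  have hsub := hasSubgaussianMGF_of_mem_Icc (μ := D x) hXm.aemeasurable
    (Filter.Eventually.of_forall hXb)
  -- The variance proxy is `(τ * r) ^ 2`; at this argument it costs `2 * β ^ 2 * lam ^ 2 * τ ^ 2 * r
  -- ^ 2` in the exponent.
  have hmgf := hsub.mgf_le (-(2 * β * lam))
  have hint := hsub.integrable_exp_mul (-(2 * β * lam))
  have hc : (((‖τ * r - -(τ * r)‖₊ / 2) ^ 2 : NNReal) : ℝ) = (τ * r) ^ 2 := by
    push_cast
    rw [Real.norm_of_nonneg (by nlinarith [mul_nonneg hτ0' (norm_nonneg (x - θs))])]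
    ring
  rw [hc] at hmgf
  set C := lam * (r ^ 2 - 2 * β * (∫ g, X g ∂(D x)) + β ^ 2 * τ ^ 2) with hC
  calc ∫⁻ g, ENNReal.ofReal (Real.exp (lam * ‖step D S p β x g - θs‖ ^ 2)) ∂(D x)
      ≤ ∫⁻ g, ENNReal.ofReal (Real.exp C *
          Real.exp (-(2 * β * lam) * (X g - ∫ g, X g ∂(D x)))) ∂(D x) := by
        refine lintegral_mono fun g => ENNReal.ofReal_le_ofReal ?_
        rw [← Real.exp_add]
        refine Real.exp_le_exp.2 ?_
        have h1 : ‖step D S p β x g - θs‖ ^ 2 ≤ r ^ 2 - 2 * β * X g + β ^ 2 * τ ^ 2 :=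
          (norm_step_sub_sq_le hScl hSc hθS hp0 β x g).trans (by gcongr)
        refine (mul_le_mul_of_nonneg_left h1 hlam.le).trans_eq ?_
        rw [hC]; ring
    _ = ENNReal.ofReal (Real.exp C * mgf (fun g => X g - ∫ g, X g ∂(D x)) (D x)
          (-(2 * β * lam))) := by
        rw [← ofReal_integral_eq_lintegral_ofReal (hint.const_mul _)
          (Filter.Eventually.of_forall fun g => by positivity), integral_const_mul]
        rfl
    _ ≤ _ := by
        refine ENNReal.ofReal_le_ofReal ?_
        refine (mul_le_mul_of_nonneg_left hmgf (Real.exp_pos _).le).trans ?_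
        rw [← Real.exp_add]
        refine Real.exp_le_exp.2 ?_
        have h1 : β * lam * m ≤ β * lam * ∫ g, X g ∂(D x) := by gcongr
        rw [hC]
        nlinarith

/-- Of the drift `2 * β * p * μ * r ^ 2`, the linear term takes half by Young's inequality and the
Hoeffding term at most a quarter; the last quarter is the contraction. The leftover constants are at
most `2 * β ^ 2 * (b ^ 2 + τ ^ 2)`, which `lam` turns into `β * p * μ / 16`. -/
theorem exponent_le {β τ b lam m r : ℝ} (hμ : 0 < μ) (hβ : 0 < β) (hp : 1 / 2 ≤ p) (hb : 0 < b)
    (hlam : lam = p * μ / (32 * β * (b ^ 2 + τ ^ 2)))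
    (hm : p * μ * r ^ 2 - √(β * μ) * b * r ≤ m) :
    lam * (r ^ 2 - 2 * β * m + β ^ 2 * τ ^ 2 + 2 * β ^ 2 * lam * τ ^ 2 * r ^ 2)
      ≤ (1 - β * p * μ / 2) * (lam * r ^ 2) + β * p * μ / 16 := by
  have hp0 : 0 < p := by linarith
  have hbt : 0 < b ^ 2 + τ ^ 2 := by positivity
  have hlam0 : 0 < lam := by rw [hlam]; positivity
  have h1 : lam * (2 * β ^ 2 * (b ^ 2 + τ ^ 2)) = β * p * μ / 16 := by
    rw [hlam]; field_simp; norm_num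
  have hs : √(β * μ) ^ 2 = β * μ := Real.sq_sqrt (by positivity)
  set s := √(β * μ)
  -- Young's inequality gives `β * b ^ 2 / p` as last term; `p ≥ 1 / 2` removes the `p`.
  have h2 : 2 * (s * b * r) ≤ p * μ * r ^ 2 + 2 * β * b ^ 2 := by
    have : p * μ * (2 * (s * b * r)) ≤ p * μ * (p * μ * r ^ 2 + 2 * β * b ^ 2) := by
      have h3 : 0 ≤ (2 * p - 1) * (β * μ * b ^ 2) := mul_nonneg (by linarith) (by positivity)
      nlinarith [sq_nonneg (p * μ * r - s * b)]
    exact le_of_mul_le_mul_left this (by positivity)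
  have h4 : 2 * β * lam * τ ^ 2 ≤ p * μ / 2 := by
    have : 2 * β * lam * τ ^ 2 ≤ 2 * β * lam * (b ^ 2 + τ ^ 2) := by gcongr; nlinarith
    have h5 : β * (2 * β * lam * (b ^ 2 + τ ^ 2)) = β * (p * μ / 16) := by linarith
    have h6 := mul_left_cancel₀ hβ.ne' h5
    nlinarith [mul_pos hp0 hμ]
  rw [← h1]
  have key : r ^ 2 - 2 * β * m + β ^ 2 * τ ^ 2 + 2 * β ^ 2 * lam * τ ^ 2 * r ^ 2
      ≤ (1 - β * p * μ / 2) * r ^ 2 + 2 * β ^ 2 * (b ^ 2 + τ ^ 2) := by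
    have h7 := mul_le_mul_of_nonneg_left hm hβ.le
    have h8 := mul_le_mul_of_nonneg_left h2 hβ.le
    have h9 := mul_le_mul_of_nonneg_left h4 (by positivity : 0 ≤ β * r ^ 2)
    nlinarith [mul_nonneg (sq_nonneg β) (sq_nonneg τ)]
  have := mul_le_mul_of_nonneg_left key hlam0.le
  linarith

end Step

end QCSGD

namespace QCSGD

variable {d : ℕ}

/-! ### Iteration of the one-step bound -/

section Chain

variable {θs : EuclideanSpace ℝ (Fin d)}
  {D : Kernel (EuclideanSpace ℝ (Fin d)) (EuclideanSpace ℝ (Fin d))} [IsMarkovKernel D]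
  {S : Set (EuclideanSpace ℝ (Fin d))} {p β : ℝ}

/-- Jensen's inequality for a concave power. -/
theorem lintegral_rpow_le_rpow_lintegral {α : Type*} [MeasurableSpace α] (m : Measure α)
    [IsProbabilityMeasure m] {F : α → ℝ≥0∞} (hF : Measurable F) {a : ℝ} (ha0 : 0 < a)
    (ha1 : a < 1) : ∫⁻ x, F x ^ a ∂m ≤ (∫⁻ x, F x ∂m) ^ a := by
  have hpq : (1 / a).HolderConjugate (1 / (1 - a)) := by
    rw [Real.holderConjugate_iff]
    refine ⟨by rw [lt_div_iff₀ ha0]; linarith, ?_⟩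
    simp
  have h := ENNReal.lintegral_mul_le_Lp_mul_Lq m hpq (hF.pow_const a).aemeasurable
    (aemeasurable_const (b := (1 : ℝ≥0∞)))
  simpa [← ENNReal.rpow_mul, ha0.ne'] using h

theorem ae_mem_bind_transition (hScl : IsClosed S) (hSc : Convex ℝ S) (hne : S.Nonempty)
    (hp0 : 0 < p) (hp1 : p < 1) (m : Measure (EuclideanSpace ℝ (Fin d))) :
    ∀ᵐ x ∂(m.bind (transition D S p β)), x ∈ S := by
  refine Measure.ae_comp_of_ae_ae hScl.measurableSet (Filter.Eventually.of_forall fun x => ?_)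
  have hs := measurable_step D hne hScl hSc hp0 hp1 β
  rw [transition, Kernel.map_apply _ hs]
  refine (ae_map_iff hs.aemeasurable hScl.measurableSet).2 ?_
  exact Filter.Eventually.of_forall fun z => (proj_spec hne hScl _).1

theorem lintegral_bind_transition (hScl : IsClosed S) (hSc : Convex ℝ S) (hne : S.Nonempty)
    (hp0 : 0 < p) (hp1 : p < 1) (m : Measure (EuclideanSpace ℝ (Fin d)))
    {F : EuclideanSpace ℝ (Fin d) → ℝ≥0∞} (hF : Measurable F) :
    ∫⁻ y, F y ∂(m.bind (transition D S p β))
      = ∫⁻ x, ∫⁻ g, F (step D S p β x g) ∂(D x) ∂m := by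
  have hs := measurable_step D hne hScl hSc hp0 hp1 β
  rw [Measure.lintegral_bind (Kernel.aemeasurable _) hF.aemeasurable]
  refine lintegral_congr fun x => ?_
  rw [transition, Kernel.lintegral_map _ hs _ hF]
  exact Kernel.lintegral_id_prod (hF.comp hs) D x

/-- The one-step bound is the Lyapunov function to the power `a < 1`, times a constant. Jensen's
inequality moves the power outside the integral, so the drift passes to the logarithm of the moment.
-/
theorem lintegral_exp_bind_transition_le (hScl : IsClosed S) (hSc : Convex ℝ S)
    (hne : S.Nonempty) (hp0 : 0 < p) (hp1 : p < 1) {a k lam y : ℝ} (ha0 : 0 < a) (ha1 : a < 1)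
    (hstep : ∀ x ∈ S, ∫⁻ g, ENNReal.ofReal (Real.exp (lam * ‖step D S p β x g - θs‖ ^ 2)) ∂(D x)
      ≤ ENNReal.ofReal (Real.exp (a * (lam * ‖x - θs‖ ^ 2) + k)))
    (m : Measure (EuclideanSpace ℝ (Fin d))) [IsProbabilityMeasure m] (hm : ∀ᵐ x ∂m, x ∈ S)
    (hy : ∫⁻ x, ENNReal.ofReal (Real.exp (lam * ‖x - θs‖ ^ 2)) ∂m
      ≤ ENNReal.ofReal (Real.exp y)) :
    ∫⁻ x, ENNReal.ofReal (Real.exp (lam * ‖x - θs‖ ^ 2)) ∂(m.bind (transition D S p β))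
      ≤ ENNReal.ofReal (Real.exp (a * y + k)) := by
  have hF : Measurable fun x : EuclideanSpace ℝ (Fin d) =>
      ENNReal.ofReal (Real.exp (lam * ‖x - θs‖ ^ 2)) := by fun_prop
  have hpow : ∀ z : ℝ, ENNReal.ofReal (Real.exp (a * z + k))
      = ENNReal.ofReal (Real.exp z) ^ a * ENNReal.ofReal (Real.exp k) := fun z => by
    rw [ENNReal.ofReal_rpow_of_pos (Real.exp_pos _), ← Real.exp_mul,
      ← ENNReal.ofReal_mul (Real.exp_pos _).le, ← Real.exp_add, mul_comm a]
  rw [lintegral_bind_transition hScl hSc hne hp0 hp1 m hF]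
  calc _ ≤ ∫⁻ x, ENNReal.ofReal (Real.exp (lam * ‖x - θs‖ ^ 2)) ^ a
          * ENNReal.ofReal (Real.exp k) ∂m := by
        refine lintegral_mono_ae ?_
        filter_upwards [hm] with x hx
        exact (hstep x hx).trans_eq (hpow _)
    _ = (∫⁻ x, ENNReal.ofReal (Real.exp (lam * ‖x - θs‖ ^ 2)) ^ a ∂m)
          * ENNReal.ofReal (Real.exp k) := lintegral_mul_const _ (hF.pow_const a)
    _ ≤ ENNReal.ofReal (Real.exp y) ^ a * ENNReal.ofReal (Real.exp k) := by
        gcongr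
        exact (lintegral_rpow_le_rpow_lintegral m hF ha0 ha1).trans (by gcongr)
    _ = _ := (hpow y).symm

/-- `c` is the fixed point of `y ↦ a * y + (1 - a) * c`. Counting starts at time `1`, since only
then is the law known to live on `S`. -/
theorem lintegral_exp_iterate_le (hScl : IsClosed S) (hSc : Convex ℝ S)
    (hSb : Bornology.IsBounded S) (hθS : θs ∈ S) (hp0 : 0 < p) (hp1 : p < 1) {a c lam : ℝ}
    (ha0 : 0 < a) (ha1 : a < 1) (hc : 0 ≤ c) (hlam : 0 ≤ lam)
    (hstep : ∀ x ∈ S, ∫⁻ g, ENNReal.ofReal (Real.exp (lam * ‖step D S p β x g - θs‖ ^ 2)) ∂(D x)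
      ≤ ENNReal.ofReal (Real.exp (a * (lam * ‖x - θs‖ ^ 2) + (1 - a) * c)))
    (m : ℕ → Measure (EuclideanSpace ℝ (Fin d))) [∀ t, IsProbabilityMeasure (m t)]
    (hm : ∀ t, m (t + 1) = (m t).bind (transition D S p β)) (t : ℕ) :
    ∫⁻ x, ENNReal.ofReal (Real.exp (lam * ‖x - θs‖ ^ 2)) ∂(m (t + 1))
      ≤ ENNReal.ofReal (Real.exp (a ^ t * (lam * Metric.diam S ^ 2) + c)) := by
  have hmem : ∀ t, ∀ᵐ x ∂(m (t + 1)), x ∈ S := fun t => by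
    rw [hm]; exact ae_mem_bind_transition hScl hSc ⟨θs, hθS⟩ hp0 hp1 _
  induction t with
  | zero =>
    calc _ ≤ ∫⁻ _, ENNReal.ofReal (Real.exp (a ^ 0 * (lam * Metric.diam S ^ 2) + c)) ∂(m 1) := by
          refine lintegral_mono_ae ?_
          filter_upwards [hmem 0] with x hx
          have hr : ‖x - θs‖ ≤ Metric.diam S := by
            rw [← dist_eq_norm]; exact Metric.dist_le_diam_of_mem hSb hx hθS
          have : lam * ‖x - θs‖ ^ 2 ≤ lam * Metric.diam S ^ 2 := by gcongr
          gcongr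
          linarith
      _ = _ := by simp
  | succ t ih =>
    rw [hm (t + 1)]
    refine (lintegral_exp_bind_transition_le hScl hSc ⟨θs, hθS⟩ hp0 hp1 ha0 ha1 hstep _
      (hmem t) ih).trans_eq ?_
    rw [pow_succ']
    ring_nf

theorem IsIterates.measurable {Ω : Type*} [MeasurableSpace Ω] {P : Measure Ω}
    {θ₀ : EuclideanSpace ℝ (Fin d)} {θ G : ℕ → Ω → EuclideanSpace ℝ (Fin d)}
    (h : IsIterates P D S p β θ₀ θ G) (hScl : IsClosed S) (hSc : Convex ℝ S) (hne : S.Nonempty)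
    (hp0 : 0 < p) (hp1 : p < 1) (t : ℕ) : Measurable (θ t) := by
  induction t with
  | zero => rw [funext h.zero]; exact measurable_const
  | succ t ih =>
    have hsucc : θ (t + 1) = fun ω => step D S p β (θ t ω) (G t ω) := funext (h.succ t)
    rw [hsucc]
    have hs := measurable_step D hne hScl hSc hp0 hp1 β
    have hc := hs.comp (ih.prodMk (h.measurable_grad t))
    exact hc

/-- The iterates form a Markov chain with the kernel `transition`. -/
theorem IsIterates.map_succ {Ω : Type*} [MeasurableSpace Ω] {P : Measure Ω}
    [IsProbabilityMeasure P]
    {θ₀ : EuclideanSpace ℝ (Fin d)} {θ G : ℕ → Ω → EuclideanSpace ℝ (Fin d)}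
    (h : IsIterates P D S p β θ₀ θ G) (hScl : IsClosed S) (hSc : Convex ℝ S) (hne : S.Nonempty)
    (hp0 : 0 < p) (hp1 : p < 1) (t : ℕ) :
    P.map (θ (t + 1)) = (P.map (θ t)).bind (transition D S p β) := by
  have hs := measurable_step D hne hScl hSc hp0 hp1 β
  have hθ := h.measurable hScl hSc hne hp0 hp1 t
  -- The conditional law given the whole history depends only on its last entry, so it is also the
  -- conditional law given `θ t`.
  have hpair : P.map (fun ω => (θ t ω, G t ω)) = P.map (θ t) ⊗ₘ D :=
    (HasCondDistrib.comp_right (hf := measurable_pi_apply _) (h.condLaw t)).map_eq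
  have : P.map (θ (t + 1)) = (P.map (θ t) ⊗ₘ D).map (fun z => step D S p β z.1 z.2) := by
    have hsucc : θ (t + 1) = fun ω => step D S p β (θ t ω) (G t ω) := funext (h.succ t)
    rw [← hpair, Measure.map_map hs (hθ.prodMk (h.measurable_grad t)), hsucc]
    rfl
  rw [this, Measure.compProd_eq_comp_prod, Measure.map_comp _ _ hs]
  rfl

end Chain

/-! ### Tail bounds -/

/-- Markov's inequality at level `e / δ`: a moment bounded by `e` leaves mass `δ`. -/
theorem measureReal_tail_le {lam v δ : ℝ} (hlam : 0 ≤ lam) (hv : 0 ≤ v) (hδ : 0 < δ)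
    (hvδ : Real.exp (lam * v ^ 2) = Real.exp 1 / δ) (θs : EuclideanSpace ℝ (Fin d))
    (m : Measure (EuclideanSpace ℝ (Fin d))) [IsProbabilityMeasure m]
    (hm : ∫⁻ x, ENNReal.ofReal (Real.exp (lam * ‖x - θs‖ ^ 2)) ∂m
      ≤ ENNReal.ofReal (Real.exp 1)) :
    m.real {x | v < ‖x - θs‖} ≤ δ := by
  have hF : Measurable fun x : EuclideanSpace ℝ (Fin d) =>
      ENNReal.ofReal (Real.exp (lam * ‖x - θs‖ ^ 2)) := by fun_prop
  have h := (mul_meas_ge_le_lintegral hF (ENNReal.ofReal (Real.exp 1 / δ))).trans hm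
  have hsub : {x : EuclideanSpace ℝ (Fin d) | v < ‖x - θs‖} ⊆
      {x | ENNReal.ofReal (Real.exp 1 / δ) ≤ ENNReal.ofReal (Real.exp (lam * ‖x - θs‖ ^ 2))} := by
    intro x hx
    have hx' : v < ‖x - θs‖ := hx
    rw [Set.mem_ofPred_eq, ← hvδ]
    gcongr
  have h2 : ENNReal.ofReal (Real.exp 1 / δ) * m {x | v < ‖x - θs‖} ≤ ENNReal.ofReal (Real.exp 1) :=
    le_trans (by gcongr) h
  have h3 := ENNReal.toReal_mono ENNReal.ofReal_ne_top h2
  rw [ENNReal.toReal_mul, ENNReal.toReal_ofReal (by positivity),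
    ENNReal.toReal_ofReal (by positivity), div_mul_eq_mul_div, div_le_iff₀ hδ] at h3
  exact le_of_mul_le_mul_left h3 (Real.exp_pos 1)

/-! ### Consequences of the step-size and quantile conditions -/

section Constants

variable {p q β μ L A : ℝ}

/-- Since `κ ≤ p * μ < μ`, the step-size condition gives `β * μ ^ 2 < μ / 4`. -/
theorem mul_lt_quarter (hμ : 0 < μ) (hA : 0 ≤ A) (hp1 : p < 1) (hβ0 : 0 < β)
    (hβ : β < 1 / 4 * (kappa p q μ A / (μ ^ 2 + 6 * L ^ 2))) : β * μ < 1 / 4 := by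
  have hp' : 0 < 1 - p := by linarith
  have hk : kappa p q μ A ≤ p * μ := by
    have : 0 ≤ (1 - p) ^ (-(1 / q)) * A * (1 - p) := by positivity
    rw [kappa]; linarith
  rw [← mul_div_assoc, lt_div_iff₀ (by positivity)] at hβ
  have h1 : 0 ≤ β * (6 * L ^ 2) := by positivity
  have h2 : β * μ * μ < 1 / 4 * μ := by nlinarith
  exact lt_of_mul_lt_mul_right h2 hμ.le

theorem half_le_of_quantile (hq : 1 < q) (hμ : 0 < μ) (hβ0 : 0 < β) (hβμ : β * μ < 1 / 4)
    (hp : 1 - (β * μ) ^ (q / (2 * (q - 1))) ≤ p) : 1 / 2 ≤ p := by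
  have hq' : 0 < q - 1 := by linarith
  have h1 : (β * μ) ^ (q / (2 * (q - 1))) ≤ (β * μ) ^ (1 / 2 : ℝ) := by
    refine Real.rpow_le_rpow_of_exponent_ge (by positivity) (by linarith) ?_
    rw [div_le_div_iff₀ (by norm_num) (by positivity)]
    linarith
  have h2 : (β * μ) ^ (1 / 2 : ℝ) ≤ 1 / 2 := by
    rw [← Real.sqrt_eq_rpow, Real.sqrt_le_left (by norm_num)]
    linarith
  linarith

/-- The exponents `q / (2 * (q - 1))` and `1 - 1 / q` multiply to `1 / 2`: the quantile condition
makes the clipping bias of order `√β`. -/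
theorem rpow_le_sqrt_of_quantile (hq : 1 < q) (hμ : 0 < μ) (hβ0 : 0 < β) (hp1 : p < 1)
    (hp : 1 - (β * μ) ^ (q / (2 * (q - 1))) ≤ p) : (1 - p) ^ (1 - 1 / q) ≤ √(β * μ) := by
  have hq' : 0 < q - 1 := by linarith
  have hq1 : 0 ≤ 1 - 1 / q := by
    rw [sub_nonneg, div_le_one (by linarith)]; exact hq.le
  calc (1 - p) ^ (1 - 1 / q) ≤ ((β * μ) ^ (q / (2 * (q - 1)))) ^ (1 - 1 / q) :=
        Real.rpow_le_rpow (by linarith) (by linarith) hq1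
    _ = √(β * μ) := by
        rw [← Real.rpow_mul (by positivity), Real.sqrt_eq_rpow]
        congr 1
        field_simp

end Constants

/-- From some time on, the chain satisfies the stationary tail bound, whatever its initial
distribution: `E exp (lam * ‖x - θs‖ ^ 2)` contracts geometrically to a value below `e`, uniformly
in the initial distribution because the first step already leads into the bounded set `S`. For an
invariant distribution the bound therefore holds outright. -/
theorem exists_forall_tail_le
    {f : EuclideanSpace ℝ (Fin d) → ℝ} {L μ : ℝ} (hμ : 0 < μ)
    (hsmooth : LipschitzSmooth f L) (hconvex : StronglyConvex f μ)
    {θs : EuclideanSpace ℝ (Fin d)} (hθs : ∀ x, f θs ≤ f x)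
    {D : Kernel (EuclideanSpace ℝ (Fin d)) (EuclideanSpace ℝ (Fin d))} [IsMarkovKernel D]
    {q A B : ℝ} (hq : 1 < q) (hA : 0 ≤ A) (hB : 0 < B)
    (hunbiased : Unbiased f D) (hmoment : NoiseMoment f D θs q A B)
    {S : Set (EuclideanSpace ℝ (Fin d))} (hSc : Convex ℝ S) (hScl : IsClosed S)
    (hSb : Bornology.IsBounded S) (hθS : θs ∈ S)
    {p β : ℝ} (hp0 : 0 < p) (hp1 : p < 1) (hβ0 : 0 < β)
    (hβ : β < 1 / 4 * (kappa p q μ A / (μ ^ 2 + 6 * L ^ 2)))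
    (hp : 1 - (β * μ) ^ (q / (2 * (q - 1))) ≤ p) :
    ∃ N : ℕ, ∀ m : ℕ → Measure (EuclideanSpace ℝ (Fin d)), (∀ t, IsProbabilityMeasure (m t)) →
      (∀ t, m (t + 1) = (m t).bind (transition D S p β)) →
      ∀ T, N ≤ T → ∀ δ, 0 < δ →
        (m T).real {x | deviation D S p β μ A B δ < ‖x - θs‖} ≤ δ := by
  have hβμ := mul_lt_quarter hμ hA hp1 hβ0 hβ
  have hph := half_le_of_quantile hq hμ hβ0 hβμ hp
  have hsq := rpow_le_sqrt_of_quantile hq hμ hβ0 hp1 hp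
  set τ := tauBar D S p with hτdef
  set b := Bbar S A B with hbdef
  have hb : 0 < b := by
    have := mul_nonneg hA (Metric.diam_nonneg (s := S))
    rw [hbdef, Bbar]; linarith
  have hbt : 0 < b ^ 2 + τ ^ 2 := by positivity
  obtain ⟨lam, hlamdef⟩ : ∃ lam, lam = p * μ / (32 * β * (b ^ 2 + τ ^ 2)) := ⟨_, rfl⟩
  have hlam : 0 < lam := by rw [hlamdef]; positivity
  set a := 1 - β * p * μ / 2 with ha
  have hbpm : 0 < β * p * μ := by positivity
  have ha1 : a < 1 := by linarith
  have ha0 : 0 < a := by nlinarith [mul_pos hβ0 hμ]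
  have hstep : ∀ x ∈ S,
      ∫⁻ g, ENNReal.ofReal (Real.exp (lam * ‖step D S p β x g - θs‖ ^ 2)) ∂(D x)
      ≤ ENNReal.ofReal (Real.exp (a * (lam * ‖x - θs‖ ^ 2) + (1 - a) * (1 / 8))) := by
    intro x hx
    have hr : ‖x - θs‖ ≤ Metric.diam S := by
      rw [← dist_eq_norm]; exact Metric.dist_le_diam_of_mem hSb hx hθS
    have hτx : threshold D p x ≤ τ := le_csSup
      (bddAbove_threshold hmoment hunbiased hsmooth hθs hq hA hB hp0 hp1 hSb hθS)
      (Set.mem_image_of_mem _ hx)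
    have hm : p * μ * ‖x - θs‖ ^ 2 - √(β * μ) * b * ‖x - θs‖
        ≤ ∫ g, inner ℝ (clipFactor (threshold D p x) g • g) (x - θs) ∂(D x) := by
      refine le_trans ?_ (le_integral_inner_clipFactor_smul hmoment hunbiased hconvex hμ hθs
        hq hA hB hp0 hp1 x)
      have : A * ‖x - θs‖ + B ≤ b := by rw [hbdef, Bbar]; gcongr
      gcongr
    refine (lintegral_exp_step_le hScl hSc hθS hp0 hβ0 hlam x hτx hm).trans ?_
    refine ENNReal.ofReal_le_ofReal (Real.exp_le_exp.2 ?_)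
    refine (exponent_le hμ hβ0 hph hb hlamdef le_rfl).trans_eq ?_
    rw [ha]; ring
  -- The limiting log-moment is `1 / 8`, so a transient below `7 / 8` keeps the moment below `e`.
  obtain ⟨N, hN⟩ := ((tendsto_pow_atTop_nhds_zero_of_lt_one ha0.le ha1).mul_const
    (lam * Metric.diam S ^ 2)).eventually (gt_mem_nhds
      (show 0 * (lam * Metric.diam S ^ 2) < 7 / 8 by norm_num)) |>.exists_forall_of_atTop
  refine ⟨N + 1, fun m hprob hm T hT δ hδ => ?_⟩
  obtain ⟨t, rfl⟩ : ∃ t, T = t + 1 := ⟨T - 1, by omega⟩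
  -- For `δ ≥ 1` the bound is trivial; otherwise the logarithm in `deviation` is nonnegative and its
  -- square root is not truncated.
  rcases le_or_gt 1 δ with hδ1 | hδ1
  · exact measureReal_le_one.trans hδ1
  have hlog : 0 ≤ Real.log (Real.exp 1 / δ) := by
    refine Real.log_nonneg ?_
    rw [le_div_iff₀ hδ]
    linarith [Real.add_one_le_exp 1]
  have hdev : lam * deviation D S p β μ A B δ ^ 2 = Real.log (Real.exp 1 / δ) := by
    rw [deviation, ← hτdef, ← hbdef, mul_pow, mul_pow, Real.sq_sqrt hbt.le,
      Real.sq_sqrt (by positivity), hlamdef]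
    field_simp
    norm_num
  refine measureReal_tail_le hlam.le (by unfold deviation; positivity) hδ ?_ θs _
    ((lintegral_exp_iterate_le hScl hSc hSb hθS hp0 hp1 ha0 ha1 (by norm_num) hlam.le hstep
      m hm t).trans ?_)
  · rw [hdev, Real.exp_log (by positivity)]
  · refine ENNReal.ofReal_le_ofReal (Real.exp_le_exp.2 ?_)
    have := hN t (by omega)
    linarith

theorem measureReal_le_add_tvDist {α : Type*} [MeasurableSpace α] (m n : Measure α)
    [IsProbabilityMeasure m] [IsProbabilityMeasure n] {E : Set α} (hE : MeasurableSet E) :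
    m.real E ≤ n.real E + tvDist m n := by
  -- Without boundedness the real supremum in `tvDist` would be a default value.
  have hb : BddAbove (Set.range fun F : {F : Set α // MeasurableSet F} =>
      |m.real F.1 - n.real F.1|) := by
    refine ⟨1, ?_⟩
    rintro _ ⟨F, rfl⟩
    exact abs_sub_le_of_nonneg_of_le measureReal_nonneg measureReal_le_one measureReal_nonneg
      measureReal_le_one
  have h := le_ciSup hb ⟨E, hE⟩
  have h2 := le_abs_self (m.real E - n.real E)
  rw [tvDist]
  linarith

end QCSGD

/-! ### The bound by burn-in, and by comparison with an invariant law -/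

theorem corollary4 {d : ℕ}
    -- the objective, smooth and strongly convex, and its minimizer
    (f : EuclideanSpace ℝ (Fin d) → ℝ) (L μ : ℝ) (hμ : 0 < μ)
    (hsmooth : QCSGD.LipschitzSmooth f L) (hconvex : QCSGD.StronglyConvex f μ)
    (θs : EuclideanSpace ℝ (Fin d)) (hθs : ∀ x, f θs ≤ f x)
    -- the distributions of the gradient samples
    (D : Kernel (EuclideanSpace ℝ (Fin d)) (EuclideanSpace ℝ (Fin d))) [IsMarkovKernel D]
    (q A B : ℝ) (hq : 1 < q) (hA : 0 ≤ A) (hB : 0 < B)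
    (hunbiased : QCSGD.Unbiased f D) (hdiffuse : QCSGD.DiffuseNoise f D)
    (hmoment : QCSGD.NoiseMoment f D θs q A B)
    -- the constraint set
    (S : Set (EuclideanSpace ℝ (Fin d))) (hSc : Convex ℝ S) (hScl : IsClosed S)
    (hSb : Bornology.IsBounded S) (hθS : θs ∈ S)
    -- the quantile and the step size
    (p β : ℝ) (hp0 : 0 < p) (hp1 : p < 1) (hβ0 : 0 < β)
    (hκ : 0 < QCSGD.kappa p q μ A)
    (hβ : β < 1 / 4 * (QCSGD.kappa p q μ A / (μ ^ 2 + 6 * L ^ 2)))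
    (hp : 1 - (β * μ) ^ (q / (2 * (q - 1))) ≤ p) :
    -- the bound holds with some geometric rate
    (∃ ρ M : ℝ, 0 ≤ ρ ∧ ρ < 1 ∧ 0 ≤ M ∧
      ∀ (Ω : Type*) [MeasurableSpace Ω] (P : Measure Ω) [IsProbabilityMeasure P]
        (θ₀ : EuclideanSpace ℝ (Fin d)) (θ G : ℕ → Ω → EuclideanSpace ℝ (Fin d)),
        QCSGD.IsIterates P D S p β θ₀ θ G →
        ∀ (T : ℕ) (δ : ℝ), 0 < δ →
          P.real {ω | QCSGD.deviation D S p β μ A B δ < ‖θ T ω - θs‖}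
            ≤ δ + ρ ^ T * M * (1 + ‖θ₀ - θs‖ ^ 2)) ∧
    -- and with every rate of convergence of the chain to an invariant distribution
    (∀ (Ω : Type*) [MeasurableSpace Ω] (P : Measure Ω) [IsProbabilityMeasure P]
      (θ₀ : EuclideanSpace ℝ (Fin d)) (θ G : ℕ → Ω → EuclideanSpace ℝ (Fin d)),
      QCSGD.IsIterates P D S p β θ₀ θ G →
      ∀ π : Measure (EuclideanSpace ℝ (Fin d)), IsProbabilityMeasure π →
        Kernel.Invariant (QCSGD.transition D S p β) π →
        ∀ ρ M : ℝ,
          (∀ T : ℕ, QCSGD.tvDist (P.map (θ T)) π ≤ M * ρ ^ T * (1 + ‖θ₀ - θs‖ ^ 2)) →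
          ∀ (T : ℕ) (δ : ℝ), 0 < δ →
            P.real {ω | QCSGD.deviation D S p β μ A B δ < ‖θ T ω - θs‖}
              ≤ δ + ρ ^ T * M * (1 + ‖θ₀ - θs‖ ^ 2)) := by
  have hne : S.Nonempty := ⟨θs, hθS⟩
  obtain ⟨N, hN⟩ := QCSGD.exists_forall_tail_le hμ hsmooth hconvex hθs hq hA hB hunbiased hmoment
    hSc hScl hSb hθS hp0 hp1 hβ0 hβ hp
  have hE : ∀ δ, MeasurableSet {x | QCSGD.deviation D S p β μ A B δ < ‖x - θs‖} := fun δ =>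
    measurableSet_lt measurable_const (by fun_prop)
  -- Any `ρ` in `(0, 1)` with `M = ρ⁻¹ ^ N` would do: the error term is at least `1` up to time `N`,
  -- and from then on it is not needed.
  refine ⟨⟨1 / 2, 2 ^ N, by norm_num, by norm_num, by positivity, ?_⟩, ?_⟩
  · intro Ω _ P _ θ₀ θ G hit T δ hδ
    have hθ := hit.measurable hScl hSc hne hp0 hp1
    rcases le_or_gt N T with hT | hT
    · have h := hN (fun t => P.map (θ t))
        (fun t => Measure.isProbabilityMeasure_map (hθ t).aemeasurable)
        (hit.map_succ hScl hSc hne hp0 hp1) T hT δ hδ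
      rw [map_measureReal_apply (hθ T) (hE δ)] at h
      exact h.trans (le_add_of_nonneg_right (by positivity))
    · have h1 : (1 : ℝ) ≤ (1 / 2) ^ T * 2 ^ N := by
        rw [one_div, inv_pow, inv_mul_eq_div, one_le_div (by positivity)]
        exact pow_le_pow_right₀ one_le_two hT.le
      have h2 : (1 : ℝ) ≤ 1 + ‖θ₀ - θs‖ ^ 2 := le_add_of_nonneg_right (by positivity)
      exact (measureReal_le_one.trans (one_le_mul_of_one_le_of_one_le h1 h2)).trans
        (le_add_of_nonneg_left hδ.le)
  · intro Ω _ P _ θ₀ θ G hit π hπ hinv ρ M htv T δ hδ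
    have hθ := hit.measurable hScl hSc hne hp0 hp1 T
    have := Measure.isProbabilityMeasure_map (μ := P) hθ.aemeasurable
    -- The constant sequence `π` solves the recursion, so its value at time `N` gives the tail of
    -- `π` itself.
    have h1 := hN (fun _ => π) (fun _ => hπ) (fun _ => hinv.symm) N le_rfl δ hδ
    have h2 := QCSGD.measureReal_le_add_tvDist (P.map (θ T)) π (hE δ)
    rw [map_measureReal_apply hθ (hE δ)] at h2
    refine h2.trans (add_le_add h1 ((htv T).trans_eq ?_))
    rw [mul_comm M]
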